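/- All regular and all normal spaces are assumed Hausdorff. Let $X$ be a topological space and $\mathcal N$ a family of subsets of $X$. The family $\mathcal N$ is called - a *$k$-network* if for every open $U\subseteq X$ and compact $K\subseteq U$ there is a finite $\mathcal F\subseteq\mathcal N$ with $K\subseteq\bigcup\mathcal F\subseteq U$; - a *$\mathsf{cs}$-network* if for every open $U\subseteq X$ and every sequence $(x_n)_{n\in\omega}$ in $X$ converging to a point of $U$ there is $N\in\mathcal N$ with $N\subseteq U$ such that $\{n\in\omega: x_n\in N\}$ is infinite; - an *$\mathsf{ap}$-network* if for every open $U\subseteq X$ and every sequence $(x_n)_{n\in\omega}$ in $X$ accumulating at some point $x\in U$ (every neighborhood of $x$ contains $x_n$ for infinitely many $n$) there is $N\in\mathcal N$ with $N\subseteq U$ such that $\{n\in\omega: x_n\in N\}$ is infinite; - an *$\mathsf{as}$-network* if for every open $U\subseteq X$ and every sequence $(F_n)_{n\in\omega}$ of closed subsets of $X$ accumulating at some point $x\in U$ (every neighborhood of $x$ meets $F_n$ for infinitely many $n$) there is $N\in\mathcal N$ with $N\subseteq U$ such that $\{n\in\omega: N\cap F_n\neq\emptyset\}$ is infinite; - *discrete*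 if every point of $X$ has a neighborhood meeting at most one member of $\mathcal N$, and *$\sigma$-discrete* if it is a countable union of discrete families. A regular space is an *$\aleph$-space* (respectively a *$\sigma_{\mathsf{ap}}$-space*) if it has a $\sigma$-discrete $k$-network (respectively a $\sigma$-discrete $\mathsf{ap}$-network). Let $C_k(X)$ be the space of continuous functions $X\to\mathbb R$ with the compact-open topology. The space $X$ is *$\mathsf{cs}$-Ascoli* if for every compact countable set $K\subseteq C_k(X)$ with a unique non-isolated point, the map $K\times X\to\mathbb R$, $(f,x)\mapsto f(x)$, is continuous. **Theorem.** Let $X$ be a $\mathsf{cs}$-Ascoli normal $\aleph$-space. Then every $\mathsf{cs}$-network in $X$ is an $\mathsf{ap}$-network and also an $\mathsf{as}$-network. Consequently, $X$ is a $\sigma_{\mathsf{ap}}$-space. -/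

import Mathlib

open Set Filter Topology

/-- A family of subsets is discrete if each point of the space has a neighborhood meeting at most
one member of the family. -/
def IsDiscreteFamily {X : Type*} [TopologicalSpace X] (𝒟 : Set (Set X)) : Prop :=
  ∀ x : X, ∃ O ∈ 𝓝 x, {D ∈ 𝒟 | (D ∩ O).Nonempty}.Subsingleton

/-- A family of subsets is `σ`-discrete if it is a countable union of discrete families. -/
def IsSigmaDiscreteFamily {X : Type*} [TopologicalSpace X] (𝒩 : Set (Set X)) : Prop :=
  ∃ 𝒟 : ℕ → Set (Set X), (∀ n, IsDiscreteFamily (𝒟 n)) ∧ 𝒩 = ⋃ n, 𝒟 n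

/-- `𝒩` is a `k`-network: for each open `U` and compact `K ⊆ U` there is a finite subfamily
`ℱ ⊆ 𝒩` with `K ⊆ ⋃ ℱ ⊆ U`. -/
def IsKNetwork {X : Type*} [TopologicalSpace X] (𝒩 : Set (Set X)) : Prop :=
  ∀ U : Set X, IsOpen U → ∀ K : Set X, IsCompact K → K ⊆ U →
    ∃ ℱ : Set (Set X), ℱ ⊆ 𝒩 ∧ ℱ.Finite ∧ K ⊆ ⋃₀ ℱ ∧ ⋃₀ ℱ ⊆ U

/-- `𝒩` is a `cs`-network: for each open `U` and each sequence converging to a point of `U`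
some member of `𝒩` inside `U` contains infinitely many terms of the sequence. -/
def IsCsNetwork {X : Type*} [TopologicalSpace X] (𝒩 : Set (Set X)) : Prop :=
  ∀ U : Set X, IsOpen U → ∀ (s : ℕ → X) (x : X), x ∈ U → Tendsto s atTop (𝓝 x) →
    ∃ N ∈ 𝒩, N ⊆ U ∧ {n : ℕ | s n ∈ N}.Infinite

/-- A sequence of points accumulates at `x` if each neighborhood of `x` contains infinitely many
terms (counted by their indices). -/
def PointsAccumulateAt {X : Type*} [TopologicalSpace X] (s : ℕ → X) (x : X) : Prop :=
  ∀ O ∈ 𝓝 x, {n : ℕ | s n ∈ O}.Infinite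

/-- A sequence of sets accumulates at `x` if each neighborhood of `x` meets infinitely many
terms (counted by their indices). -/
def SetsAccumulateAt {X : Type*} [TopologicalSpace X] (F : ℕ → Set X) (x : X) : Prop :=
  ∀ O ∈ 𝓝 x, {n : ℕ | (O ∩ F n).Nonempty}.Infinite

/-- `𝒩` is an `ap`-network ("accumulating sequence of points"). -/
def IsApNetwork {X : Type*} [TopologicalSpace X] (𝒩 : Set (Set X)) : Prop :=
  ∀ U : Set X, IsOpen U → ∀ (s : ℕ → X) (x : X), x ∈ U → PointsAccumulateAt s x →
    ∃ N ∈ 𝒩, N ⊆ U ∧ {n : ℕ | s n ∈ N}.Infinite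

/-- `𝒩` is an `as`-network ("accumulating sequence of closed sets"). -/
def IsAsNetwork {X : Type*} [TopologicalSpace X] (𝒩 : Set (Set X)) : Prop :=
  ∀ U : Set X, IsOpen U → ∀ (F : ℕ → Set X) (x : X), (∀ n, IsClosed (F n)) → x ∈ U →
    SetsAccumulateAt F x → ∃ N ∈ 𝒩, N ⊆ U ∧ {n : ℕ | (N ∩ F n).Nonempty}.Infinite

/-- A convergent sequence, as a set: a compact countable set with a unique non-isolated point
(with respect to the subspace topology). -/
def IsConvergentSequenceSet {Y : Type*} [TopologicalSpace Y] (K : Set Y) : Prop :=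
  IsCompact K ∧ K.Countable ∧ ∃! p : K, ¬ IsOpen ({p} : Set K)

/-- `X` is `cs`-Ascoli (sequentially Ascoli): for each convergent sequence `K` in the space
`C(X, ℝ)` with the compact-open topology, the evaluation map `K × X → ℝ` is continuous. -/
def IsCsAscoli (X : Type*) [TopologicalSpace X] : Prop :=
  ∀ K : Set C(X, ℝ), IsConvergentSequenceSet K →
    Continuous (fun p : K × X => (p.1 : C(X, ℝ)) p.2)

/-- An `ℵ`-space: a regular (Hausdorff) space with a `σ`-discrete `k`-network. -/
def IsAlephSpace (X : Type*) [TopologicalSpace X] : Prop :=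
  T3Space X ∧ ∃ 𝒩 : Set (Set X), IsSigmaDiscreteFamily 𝒩 ∧ IsKNetwork 𝒩

/-- A `σ_ap`-space: a regular (Hausdorff) space with a `σ`-discrete `ap`-network. -/
def IsSigmaApSpace (X : Type*) [TopologicalSpace X] : Prop :=
  T3Space X ∧ ∃ 𝒩 : Set (Set X), IsSigmaDiscreteFamily 𝒩 ∧ IsApNetwork 𝒩

/-! The crux is that a compact-finite sequence of closed sets `F n` cannot accumulate at a point.
The network expands it to compact-finite open sets `W n`. Urysohn functions equal to 1 on `F n` and
0 off `W n` then tend to zero in the compact-open topology, and continuity of evaluation at `(0, x)`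
forces `F n` to miss a neighborhood of `x` for large `n`. So if closed sets accumulate at a point of
`U`, infinitely many of them meet one compact set inside a closed neighborhood contained in `U`.
Compact sets here are sequentially compact, which yields a convergent sequence to which the
`cs`-network property applies. -/

/-- The image of a discrete family under closure is discrete. -/
theorem IsDiscreteFamily.image_closure {X : Type*} [TopologicalSpace X] {𝒟 : Set (Set X)}
    (h : IsDiscreteFamily 𝒟) : IsDiscreteFamily (closure '' 𝒟) := by
  intro x
  obtain ⟨O, hO, hs⟩ := h x
  refine ⟨interior O, interior_mem_nhds.2 hO, ?_⟩
  rintro _ ⟨⟨A, hA, rfl⟩, hAO⟩ _ ⟨⟨B, hB, rfl⟩, hBO⟩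
  have key : ∀ C : Set X, (closure C ∩ interior O).Nonempty → (C ∩ O).Nonempty := by
    intro C hC
    exact ((closure_inter_open_nonempty_iff isOpen_interior).1 hC).mono
      (inter_subset_inter_right _ interior_subset)
  rw [hs ⟨hA, key A hAO⟩ ⟨hB, key B hBO⟩]

/-- A `k`-network presented as an increasing union of locally finite families of closed sets. -/
structure IsLocallyFiniteKNetwork {X : Type*} [TopologicalSpace X]
    (ℰ : ℕ → Set (Set X)) : Prop where
  mono : Monotone ℰ
  isClosed : ∀ n, ∀ D ∈ ℰ n, IsClosed D
  locallyFinite : ∀ n, LocallyFinite (fun D : ℰ n => (D : Set X))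
  exists_cover : ∀ U : Set X, IsOpen U → ∀ K : Set X, IsCompact K → K ⊆ U →
    ∃ n, ∃ ℱ ⊆ ℰ n, ℱ.Finite ∧ K ⊆ ⋃₀ ℱ ∧ ⋃₀ ℱ ⊆ U

theorem IsAlephSpace.exists_isLocallyFiniteKNetwork {X : Type*} [TopologicalSpace X]
    (h : IsAlephSpace X) : ∃ ℰ : ℕ → Set (Set X), IsLocallyFiniteKNetwork ℰ := by
  obtain ⟨hreg, 𝒩, ⟨𝒟, h𝒟, rfl⟩, hk⟩ := h
  refine ⟨fun n => ⋃ i ∈ Iic n, closure '' 𝒟 i, ?_, ?_, ?_, ?_⟩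
  · intro m n hmn
    exact biUnion_subset_biUnion_left (Iic_subset_Iic.2 hmn)
  · intro n D hD
    simp only [mem_iUnion] at hD
    obtain ⟨i, _, A, _, rfl⟩ := hD
    exact isClosed_closure
  · intro n x
    have hl : ∀ i, ∃ O ∈ 𝓝 x, {D ∈ closure '' 𝒟 i | (D ∩ O).Nonempty}.Subsingleton :=
      fun i => (h𝒟 i).image_closure x
    choose O hO hs using hl
    refine ⟨⋂ i ∈ Iic n, O i, (biInter_mem (finite_Iic n)).2 fun i _ => hO i, ?_⟩
    refine Set.Finite.of_finite_image (f := Subtype.val) ?_ Subtype.val_injective.injOn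
    refine ((finite_Iic n).biUnion fun i _ => (hs i).finite).subset ?_
    rintro _ ⟨⟨D, hD⟩, hne, rfl⟩
    simp only [mem_iUnion] at hD ⊢
    obtain ⟨i, hi, hDi⟩ := hD
    exact ⟨i, hi, hDi, hne.mono (inter_subset_inter_right _ (biInter_subset_of_mem hi))⟩
  · intro U hU K hK hKU
    -- Shrinking `U` first keeps the closures of the chosen members inside `U`.
    obtain ⟨V, hV, hKV, hVU⟩ : ∃ V, IsOpen V ∧ K ⊆ V ∧ closure V ⊆ U := by
      obtain ⟨V, hV, hKV, hVU⟩ := hK.exists_isOpen_closure_subset (hU.mem_nhdsSet.2 hKU)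
      exact ⟨V, hV, hKV, hVU⟩
    obtain ⟨ℱ, hℱ, hfin, hKℱ, hℱV⟩ := hk V hV K hK hKV
    have hidx : ∀ A : Set X, ∃ i, A ∈ ℱ → A ∈ 𝒟 i := by
      intro A
      by_cases hA : A ∈ ℱ
      · obtain ⟨i, hi⟩ := mem_iUnion.1 (hℱ hA)
        exact ⟨i, fun _ => hi⟩
      · exact ⟨0, fun h => absurd h hA⟩
    choose i hi using hidx
    obtain ⟨n, hn⟩ := (hfin.image i).bddAbove
    refine ⟨n, closure '' ℱ, ?_, hfin.image _, ?_, ?_⟩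
    · rintro _ ⟨A, hA, rfl⟩
      exact mem_biUnion (x := i A) (hn (mem_image_of_mem _ hA)) (mem_image_of_mem _ (hi A hA))
    · intro y hy
      obtain ⟨A, hA, hyA⟩ := hKℱ hy
      exact ⟨_, mem_image_of_mem _ hA, subset_closure hyA⟩
    · rintro y ⟨_, ⟨A, hA, rfl⟩, hy⟩
      exact hVU (closure_mono ((subset_sUnion_of_mem hA).trans hℱV) hy)

/-- Compact sets in a space with a `σ`-locally finite closed `k`-network are second countable. -/
theorem IsLocallyFiniteKNetwork.secondCountableTopology {X : Type*} [TopologicalSpace X]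
    [T2Space X] {ℰ : ℕ → Set (Set X)} (h : IsLocallyFiniteKNetwork ℰ) {K : Set X}
    (hK : IsCompact K) : SecondCountableTopology K := by
  set 𝒞 : Set (Set X) := {D | (D ∩ K).Nonempty ∧ ∃ n, D ∈ ℰ n} with h𝒞
  have hcount : 𝒞.Countable := by
    have hfin : ∀ n, {D ∈ ℰ n | (D ∩ K).Nonempty}.Finite := by
      intro n
      refine (((h.locallyFinite n).finite_nonempty_inter_compact hK).image Subtype.val).subset ?_
      rintro D ⟨hD, hne⟩
      exact ⟨⟨D, hD⟩, hne, rfl⟩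
    refine (countable_iUnion fun n => (hfin n).countable).mono ?_
    rintro D ⟨hne, n, hn⟩
    exact mem_iUnion.2 ⟨n, hn, hne⟩
  -- Basic sets are traces of complements of finite unions from `𝒞`: to separate `p` from the
  -- compact set `K \ V`, cover the latter by finitely many members missing `p`.
  set ℬ : Set (Set K) :=
    (fun ℱ : Set (Set X) => (Subtype.val ⁻¹' (⋃₀ ℱ)ᶜ : Set K)) '' {ℱ | ℱ.Finite ∧ ℱ ⊆ 𝒞}
    with hℬ
  have hbasis : TopologicalSpace.IsTopologicalBasis ℬ := by
    refine TopologicalSpace.isTopologicalBasis_of_isOpen_of_nhds ?_ ?_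
    · rintro _ ⟨ℱ, ⟨hfin, hsub⟩, rfl⟩
      refine IsOpen.preimage continuous_subtype_val (IsClosed.isOpen_compl (self := ?_))
      rw [sUnion_eq_biUnion]
      refine hfin.isClosed_biUnion fun D hD => ?_
      obtain ⟨_, n, hn⟩ := hsub hD
      exact h.isClosed n D hn
    · rintro p _ hp ⟨V, hV, rfl⟩
      obtain ⟨n, ℱ, hℱ, hfin, hcov, hsub⟩ := h.exists_cover {(p : X)}ᶜ isOpen_compl_singleton
        (K \ V) (hK.diff hV) (by
          rintro y ⟨_, hy⟩ rfl
          exact hy hp)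
      refine ⟨_, ⟨{D ∈ ℱ | (D ∩ K).Nonempty}, ⟨hfin.subset (sep_subset _ _),
        fun D hD => ⟨hD.2, n, hℱ hD.1⟩⟩, rfl⟩, ?_, ?_⟩
      · rintro ⟨D, hD, hpD⟩
        exact hsub ⟨D, hD.1, hpD⟩ rfl
      · intro y hy
        by_contra hyV
        obtain ⟨D, hD, hyD⟩ := hcov ⟨y.2, hyV⟩
        exact hy ⟨D, ⟨hD, y, hyD, y.2⟩, hyD⟩
  exact hbasis.secondCountableTopology ((countable_ofPred_finite_subset hcount).image _)

/-- Compactness alone would not suffice; second countability of `K` supplies the convergent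
subsequences. -/
theorem IsLocallyFiniteKNetwork.isSeqCompact {X : Type*} [TopologicalSpace X]
    [T2Space X] {ℰ : ℕ → Set (Set X)} (h : IsLocallyFiniteKNetwork ℰ) {K : Set X}
    (hK : IsCompact K) : IsSeqCompact K := by
  have := h.secondCountableTopology hK
  have : CompactSpace K := isCompact_iff_compactSpace.1 hK
  intro s hs
  obtain ⟨a, φ, hφ, ha⟩ := CompactSpace.tendsto_subseq (fun n => (⟨s n, hs n⟩ : K))
  exact ⟨a, a.2, φ, hφ, (continuous_subtype_val.tendsto a).comp ha⟩

/-- Adding to a compact set points almost all of which lie in each neighborhood of that set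
results in a compact set. -/
theorem IsCompact.union_of_finite_diff {X : Type*} [TopologicalSpace X] {K S : Set X}
    (hK : IsCompact K) (hS : ∀ U, IsOpen U → K ⊆ U → (S \ U).Finite) : IsCompact (K ∪ S) := by
  refine isCompact_of_finite_subcover fun {ι} U hU hcov => ?_
  obtain ⟨t, ht⟩ := hK.elim_finite_subcover U hU (subset_union_left.trans hcov)
  have hfin := hS _ (isOpen_biUnion fun i (_ : i ∈ t) => hU i) ht
  obtain ⟨t', ht'⟩ := hfin.isCompact.elim_finite_subcover U hU
    (sdiff_subset.trans (subset_union_right.trans hcov))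
  classical
  refine ⟨t ∪ t', ?_⟩
  rw [Finset.set_biUnion_union]
  rintro y (hy | hy)
  · exact Or.inl (ht hy)
  · by_cases hyt : y ∈ ⋃ i ∈ t, U i
    · exact Or.inl hyt
    · exact Or.inr (ht' ⟨hy, hyt⟩)

/-- A sequence of sets is compact-finite if each compact set meets only finitely many terms. -/
def CompactFinite {X : Type*} [TopologicalSpace X] (F : ℕ → Set X) : Prop :=
  ∀ K : Set X, IsCompact K → {n : ℕ | (K ∩ F n).Nonempty}.Finite

/-- Compact-finite sequences of sets have compact-finite open expansions. -/
theorem IsLocallyFiniteKNetwork.exists_open_expansion {X : Type*} [TopologicalSpace X]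
    {ℰ : ℕ → Set (Set X)} (h : IsLocallyFiniteKNetwork ℰ) {F : ℕ → Set X}
    (hF : CompactFinite F) :
    ∃ W : ℕ → Set X, (∀ n, IsOpen (W n)) ∧ (∀ n, F n ⊆ W n) ∧ CompactFinite W := by
  -- `A n y` is the intersection of the members of `ℰ n` containing `y`. By local finiteness, points
  -- `y'` near `y` lie in no member missing `y`, so `A n y ⊆ A n y'`; this makes the expansion open.
  set A : ℕ → X → Set X := fun n y => {z | ∀ D ∈ ℰ n, y ∈ D → z ∈ D} with hA
  refine ⟨fun n => {y | (A n y ∩ F n).Nonempty}, ?_, ?_, ?_⟩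
  · intro n
    rw [isOpen_iff_mem_nhds]
    rintro y ⟨z, hzA, hzF⟩
    filter_upwards [(h.locallyFinite n).iInter_compl_mem_nhds (fun D => h.isClosed n D D.2) y]
      with y' hy'
    refine ⟨z, fun D hD hyD => hzA D hD ?_, hzF⟩
    by_contra hy
    simp only [mem_iInter] at hy'
    exact hy' ⟨D, hD⟩ hy hyD
  · exact fun n y hy => ⟨y, fun _ _ h => h, hy⟩
  · intro K hK
    by_contra hinf
    set I := {n : ℕ | (K ∩ {y | (A n y ∩ F n).Nonempty}).Nonempty} with hI
    have hex : ∀ n, ∃ z, n ∈ I → z ∈ F n ∧ ∃ y ∈ K, z ∈ A n y := by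
      intro n
      by_cases hn : n ∈ I
      · obtain ⟨y, hy, z, hz, hzF⟩ := hn
        exact ⟨z, fun _ => ⟨hzF, y, hy, hz⟩⟩
      · by_cases hX : Nonempty X
        · exact ⟨hX.some, fun h => absurd h hn⟩
        · exact absurd (show I = ∅ from eq_empty_of_forall_notMem fun m hm =>
            hX ⟨hm.some⟩) fun h0 => hinf (h0 ▸ finite_empty)
    choose z hz using hex
    -- For `U ⊇ K`, a cover of `K` taken from `ℰ m` inside `U` traps `A n y` in `U` for all `y ∈ K`
    -- and `n ≥ m`, hence all but finitely many of the `z n`.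
    have hcomp : IsCompact (K ∪ z '' I) := by
      refine hK.union_of_finite_diff fun U hU hKU => ?_
      obtain ⟨m, ℱ, hℱ, -, hcov, hsub⟩ := h.exists_cover U hU K hK hKU
      refine ((finite_Iio m).image z).subset ?_
      rintro _ ⟨⟨n, hn, rfl⟩, hnU⟩
      refine mem_image_of_mem _ (mem_Iio.2 (not_le.1 fun hmn => hnU ?_))
      obtain ⟨-, y, hyK, hzy⟩ := hz n hn
      obtain ⟨D, hD, hyD⟩ := hcov hyK
      exact hsub ⟨D, hD, hzy D (h.mono hmn (hℱ hD)) hyD⟩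
    exact hinf ((hF _ hcomp).subset fun n hn =>
      ⟨z n, Or.inr (mem_image_of_mem _ hn), (hz n hn).1⟩)

/-- Functions vanishing off a compact-finite sequence of sets tend to zero in the compact-open
topology. -/
theorem CompactFinite.tendsto_zero {X : Type*} [TopologicalSpace X] {W : ℕ → Set X}
    (hW : CompactFinite W) {f : ℕ → C(X, ℝ)} (hf : ∀ n, ∀ y ∉ W n, f n y = 0) :
    Tendsto f atTop (𝓝 0) := by
  rw [ContinuousMap.tendsto_iff_forall_isCompact_tendstoUniformlyOn]
  intro K hK u hu
  have hev := (hW K hK).eventually_cofinite_notMem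
  rw [Nat.cofinite_eq_atTop] at hev
  filter_upwards [hev] with n hn y hy
  rw [hf n y fun hyW => hn ⟨y, hy, hyW⟩]
  exact refl_mem_uniformity hu

/-- The range of a sequence converging to zero in the compact-open topology, together with zero,
is a convergent sequence provided that the functions are supported on a compact-finite sequence
of sets and infinitely many of them are nonzero. -/
theorem CompactFinite.isConvergentSequenceSet {X : Type*} [TopologicalSpace X] {W : ℕ → Set X}
    (hW : CompactFinite W) {f : ℕ → C(X, ℝ)} (hf : ∀ n, ∀ y ∉ W n, f n y = 0)
    (hne : {n | f n ≠ 0}.Infinite) : IsConvergentSequenceSet (insert 0 (range f)) := by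
  have hlim := hW.tendsto_zero hf
  refine ⟨hlim.isCompact_insert_range, (countable_range f).insert 0, ⟨0, mem_insert _ _⟩, ?_, ?_⟩
  · intro hopen
    have hlim' : Tendsto (fun n => (⟨f n, Or.inr (mem_range_self n)⟩ : ↥(insert 0 (range f))))
        atTop (𝓝 ⟨0, mem_insert _ _⟩) := tendsto_subtype_rng.2 hlim
    have hev := hlim'.eventually (hopen.mem_nhds rfl)
    rw [← Nat.cofinite_eq_atTop] at hev
    refine hne (hev.subset ?_)
    intro n hn h0
    exact hn (congrArg Subtype.val h0)
  · rintro ⟨g, hg⟩ hgiso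
    by_contra hg0
    have hg0' : g ≠ 0 := fun h => hg0 (Subtype.ext h)
    obtain ⟨p, hp⟩ : ∃ p, g p ≠ 0 := by
      by_contra! hall
      exact hg0' (ContinuousMap.ext hall)
    refine hgiso ?_
    -- Only finitely many `W n` contain `p`, so this open neighborhood of `g` is finite, and `g` is
    -- isolated.
    set O : Set ↥(insert (0 : C(X, ℝ)) (range f)) := {q | q.1 p ≠ 0} with hO
    have hOopen : IsOpen O := by
      refine isOpen_ne.preimage ?_
      exact (continuous_eval_const (F := C(X, ℝ)) p).comp continuous_subtype_val
    have hOfin : O.Finite := by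
      refine Set.Finite.of_finite_image (f := Subtype.val) ?_ Subtype.val_injective.injOn
      refine ((hW {p} isCompact_singleton).image f).subset ?_
      rintro _ ⟨⟨q, hq⟩, hqp, rfl⟩
      rcases hq with rfl | ⟨n, rfl⟩
      · exact absurd rfl hqp
      · refine ⟨n, ⟨p, rfl, ?_⟩, rfl⟩
        by_contra hpW
        exact hqp (hf n p hpW)
    have : ({⟨g, hg⟩} : Set ↥(insert (0 : C(X, ℝ)) (range f))) = O \ (O \ {⟨g, hg⟩}) := by
      rw [sdiff_sdiff_cancel_left]
      exact singleton_subset_iff.2 hp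
    rw [this]
    exact hOopen.sdiff (hOfin.subset sdiff_subset).isClosed

/-- In a normal `cs`-Ascoli `ℵ`-space compact-finite sequences of closed sets do not accumulate
at any point. -/
theorem IsCsAscoli.not_setsAccumulateAt {X : Type*} [TopologicalSpace X] [T4Space X]
    (hAscoli : IsCsAscoli X) {ℰ : ℕ → Set (Set X)} (h : IsLocallyFiniteKNetwork ℰ)
    {F : ℕ → Set X} (hclosed : ∀ n, IsClosed (F n)) (hF : CompactFinite F) (x : X) :
    ¬ SetsAccumulateAt F x := by
  intro hacc
  obtain ⟨W, hWo, hFW, hW⟩ := h.exists_open_expansion hF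
  have hury : ∀ n, ∃ f : C(X, ℝ), (∀ y ∉ W n, f y = 0) ∧ ∀ y ∈ F n, f y = 1 := by
    intro n
    obtain ⟨f, h0, h1, -⟩ := exists_continuous_zero_one_of_isClosed (hWo n).isClosed_compl
      (hclosed n) (disjoint_compl_left_iff_subset.2 (hFW n))
    exact ⟨f, fun y hy => h0 hy, fun y hy => h1 hy⟩
  choose f hf0 hf1 using hury
  have hne : {n | f n ≠ 0}.Infinite := by
    refine (hacc univ univ_mem).mono ?_
    rintro n ⟨y, -, hy⟩ h0
    have := hf1 n y hy
    rw [h0] at this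
    exact zero_ne_one this
  have hcont := hAscoli _ (hW.isConvergentSequenceSet hf0 hne)
  have hlim : Tendsto (fun n => (⟨f n, Or.inr (mem_range_self n)⟩ : ↥(insert 0 (range f))))
      atTop (𝓝 ⟨0, mem_insert _ _⟩) := tendsto_subtype_rng.2 (hW.tendsto_zero hf0)
  have hev := (hcont.tendsto (⟨0, mem_insert _ _⟩, x)).eventually
    (show ∀ᶠ r in 𝓝 ((0 : C(X, ℝ)) x), r < 1 from gt_mem_nhds zero_lt_one)
  rw [nhds_prod_eq] at hev
  obtain ⟨P, hP, O, hO, hPO⟩ := eventually_prod_iff.1 hev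
  have hP' := hlim.eventually hP
  rw [← Nat.cofinite_eq_atTop] at hP'
  -- Infinitely many `F n` meet `O`, while only finitely many `f n` fall outside `P`.
  obtain ⟨n, ⟨y, hyO, hyF⟩, hn⟩ := ((hacc {y | O y} hO).sdiff hP').nonempty
  have := hPO (not_not.1 hn) hyO
  simp only [hf1 n y hyF] at this
  exact lt_irrefl _ this

theorem IsCsNetwork.isAsNetwork {X : Type*} [TopologicalSpace X] [T4Space X]
    (hAscoli : IsCsAscoli X) (hAleph : IsAlephSpace X) {𝒩 : Set (Set X)} (h𝒩 : IsCsNetwork 𝒩) :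
    IsAsNetwork 𝒩 := by
  obtain ⟨ℰ, h⟩ := hAleph.exists_isLocallyFiniteKNetwork
  intro U hU F x hclosed hx hacc
  -- Intersecting with a closed `V` keeps the limit `a` found below inside `U`.
  obtain ⟨V, hV, hVc, hVU⟩ := exists_mem_nhds_isClosed_subset (hU.mem_nhds hx)
  have hacc' : SetsAccumulateAt (fun n => F n ∩ V) x := by
    intro O hO
    refine (hacc (O ∩ V) (inter_mem hO hV)).mono ?_
    rintro n ⟨y, ⟨hyO, hyV⟩, hyF⟩
    exact ⟨y, hyO, hyF, hyV⟩
  have hnot := mt (hAscoli.not_setsAccumulateAt h (fun n => (hclosed n).inter hVc) · x)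
    (not_not.2 hacc')
  simp only [CompactFinite, not_forall] at hnot
  obtain ⟨K, hK, hinf⟩ := hnot
  obtain ⟨e, hmono, he⟩ := extraction_of_frequently_atTop
    (Nat.frequently_atTop_iff_infinite.2 hinf)
  choose y hyK hy using he
  obtain ⟨a, -, φ, hφ, ha⟩ := h.isSeqCompact hK hyK
  have haV : a ∈ V := hVc.mem_of_tendsto ha (Eventually.of_forall fun k => (hy (φ k)).2)
  obtain ⟨N, hN, hNU, hNinf⟩ := h𝒩 U hU _ a (hVU haV) ha
  refine ⟨N, hN, hNU, ?_⟩
  refine (hNinf.image (f := fun k => e (φ k)) (hmono.injective.comp hφ.injective).injOn).mono ?_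
  rintro _ ⟨k, hk, rfl⟩
  exact ⟨_, hk, (hy (φ k)).1⟩

theorem IsAsNetwork.isApNetwork {X : Type*} [TopologicalSpace X] [T1Space X]
    {𝒩 : Set (Set X)} (h : IsAsNetwork 𝒩) : IsApNetwork 𝒩 := by
  intro U hU s x hx hacc
  have := h U hU (fun n => {s n}) x (fun n => isClosed_singleton) hx
  simp only [SetsAccumulateAt, inter_singleton_nonempty] at this
  exact this hacc

/-- A tail lying in `U`, together with its limit, is compact; one of the finitely many members
covering it must contain infinitely many terms. -/
theorem IsKNetwork.isCsNetwork {X : Type*} [TopologicalSpace X] {𝒩 : Set (Set X)}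
    (h : IsKNetwork 𝒩) : IsCsNetwork 𝒩 := by
  intro U hU s x hx hs
  obtain ⟨m, hm⟩ := eventually_atTop.1 (hs.eventually (hU.mem_nhds hx))
  obtain ⟨ℱ, hℱ, hfin, hcov, hsub⟩ := h U hU (insert x (range fun n => s (n + m)))
    ((tendsto_add_atTop_iff_nat m).2 hs).isCompact_insert_range (by
      rintro _ (rfl | ⟨n, rfl⟩)
      · exact hx
      · exact hm _ (Nat.le_add_left m n))
  by_contra! hno
  refine (Ici_infinite m) ((hfin.biUnion fun N hN => hno N (hℱ hN)
    ((subset_sUnion_of_mem hN).trans hsub)).subset ?_)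
  intro n hn
  obtain ⟨N, hN, hnN⟩ := hcov (Or.inr ⟨n - m, rfl⟩)
  simp only [Nat.sub_add_cancel (mem_Ici.1 hn)] at hnN
  exact mem_biUnion hN hnN

theorem theorem1p7 {X : Type*} [TopologicalSpace X] [T4Space X]
    (hAscoli : IsCsAscoli X) (hAleph : IsAlephSpace X) :
    (∀ 𝒩 : Set (Set X), IsCsNetwork 𝒩 → IsApNetwork 𝒩 ∧ IsAsNetwork 𝒩) ∧
      IsSigmaApSpace X := by
  have key : ∀ 𝒩 : Set (Set X), IsCsNetwork 𝒩 → IsApNetwork 𝒩 ∧ IsAsNetwork 𝒩 := fun 𝒩 h𝒩 =>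
    ⟨(h𝒩.isAsNetwork hAscoli hAleph).isApNetwork, h𝒩.isAsNetwork hAscoli hAleph⟩
  refine ⟨key, hAleph.1, ?_⟩
  obtain ⟨-, 𝒩, hσ, hk⟩ := hAleph
  exact ⟨𝒩, hσ, (key 𝒩 hk.isCsNetwork).1⟩
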